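/- Let $\mathsf{Graph}$ be the category of finite simple undirected graphs and graph homomorphisms, and let $(\mathfrak{C},\epsilon,\delta)$ be a comonad on $\mathsf{Graph}$ with Eilenberg--Moore category $\mathrm{EM}(\mathfrak{C})$, forgetful functor $U^{\mathfrak{C}}\colon \mathrm{EM}(\mathfrak{C})\to\mathsf{Graph}$ and (co)free functor $F^{\mathfrak{C}}\colon G\mapsto(\mathfrak{C}G,\delta_G)$, right adjoint to $U^{\mathfrak{C}}$. For a coalgebra $(A,\alpha)$ and a homomorphism $f\colon A\to G$, let $\widehat f\colon (A,\alpha)\to F^{\mathfrak{C}}G$ be the corresponding coalgebra morphism. Fix a graph $L$ that carries at least one $\mathfrak{C}$-coalgebra structure (i.e. $L\in\operatorname{im}U^{\mathfrak{C}}$). Let $\Lambda(\mathfrak{C},L)$ consist of a fresh symbol $\bot$ and of all bilabelled coalgebras $\boldsymbol{A}=((L,\lambda)\to(A,\alpha)\leftarrow(L,\kappa))$, where $\lambda,\kappa$ are coalgebra structures on $L$ and the arrows are morphisms of $\mathrm{EM}(\mathfrak{C})$; elements are considered up to isomorphism of $(A,\alpha)$ in $\mathrm{EM}(\mathfrak{C})$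 commuting with the two arrows (with $\lambda,\kappa$ fixed). The graph underlying $\boldsymbol{A}\neq\bot$ is $A$. The reverse of $(L,\lambda)\to(A,\alpha)\leftarrow(L,\kappa)$ is $(L,\kappa)\to(A,\alpha)\leftarrow(L,\lambda)$, and the reverse of $\bot$ is $\bot$. The series composition of $(L,\lambda)\to(A,\alpha)\leftarrow(L,\kappa)$ and $(L,\kappa')\to(B,\beta)\leftarrow(L,\mu)$ is $(L,\lambda)\to(C,\gamma)\leftarrow(L,\mu)$, where $(C,\gamma)$ is the pushout of $(A,\alpha)\leftarrow(L,\kappa)\to(B,\beta)$ in $\mathrm{EM}(\mathfrak{C})$, if $\kappa=\kappa'$ and this pushout exists; otherwise, and whenever one factor is $\bot$, it is $\bot$. A set $\Gamma\subseteq\Lambda(\mathfrak{C},L)$ is a set of generators if every element of $\Lambda(\mathfrak{C},L)$ is a series composition $\boldsymbol{B}^1\cdots\boldsymbol{B}^r$ of finitely many elements ($r\ge 1$) of $\Gamma$. For a graph $G$, write $\operatorname{mor}(L,G)$ for the set of homomorphisms $L\to G$. For $\boldsymbol{A}=((L,\lambda)\xrightarrow{a_1}(A,\alpha)\xleftarrow{a_2}(L,\kappa))$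 let $\boldsymbol{A}_G\in\mathbb{C}^{\operatorname{mor}(L,G)\times\operatorname{mor}(L,G)}$ be the matrix whose $(\ell,k)$ entry is the number of homomorphisms $h\colon A\to G$ with $\widehat h a_1=\widehat\ell$ and $\widehat h a_2=\widehat k$, where $\widehat\ell,\widehat k$ are taken with respect to $(L,\lambda)$ and $(L,\kappa)$. The augmented homomorphism representation is $\widehat{\boldsymbol{A}}_G:=\boldsymbol{A}_G\otimes e_\lambda e_\kappa^{T}$, a square matrix indexed by pairs of an element of $\operatorname{mor}(L,G)$ and a coalgebra structure on $L$; the symbol $\bot$ is sent to the zero matrix. **Theorem.** Suppose that $\Gamma$ is a (possibly infinite) set of generators for $\Lambda(\mathfrak{C},L)$ which is closed under reversal. Then for all graphs $G$ and $H$ the following are equivalent: 1. $G$ and $H$ are homomorphism indistinguishable over the graphs underlying the elements of $\Lambda(\mathfrak{C},L)\setminus\{\bot\}$, i.e. every such graph has the same number of homomorphisms to $G$ as to $H$. 2. There is a complex pseudo-stochastic matrix $X$ (all row sums and all column sums equal one), with rows indexed by $\operatorname{mor}(L,H)\times\{\text{coalgebra structures on }L\}$ and columns by $\operatorname{mor}(L,G)\times\{\text{coalgebra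 structures on }L\}$, such that $X\,\widehat{\boldsymbol{A}}_G=\widehat{\boldsymbol{A}}_H\,X$ for all $\boldsymbol{A}\in\Gamma$. -/

import Mathlib

open CategoryTheory CategoryTheory.Limits
open scoped Kronecker

universe u

/-! ### The category of finite simple graphs -/

/-- A finite simple undirected graph. -/
structure FinGraph : Type (u + 1) where
  V : Type u
  finite : Finite V
  graph : SimpleGraph V

/-- The category `Graph`: morphisms are graph homomorphisms. -/
instance FinGraph.category : Category.{u} FinGraph.{u} where
  Hom A B := A.graph →g B.graph
  id A := SimpleGraph.Hom.id
  comp f g := SimpleGraph.Hom.comp g f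

instance FinGraph.finite_hom (A B : FinGraph.{u}) : Finite (A ⟶ B) := by
  have := A.finite
  have := B.finite
  exact DFunLike.finite (A.graph →g B.graph)

noncomputable instance FinGraph.fintype_hom (A B : FinGraph.{u}) : Fintype (A ⟶ B) :=
  Fintype.ofFinite _

/-- `G` and `H` are homomorphism indistinguishable over the class `𝓕`: every `F ∈ 𝓕` has the same
number of homomorphisms to `G` and to `H`. -/
def HomIndistinguishable (𝓕 : Set FinGraph.{u}) (G H : FinGraph.{u}) : Prop :=
  ∀ F ∈ 𝓕, Nat.card (F ⟶ G) = Nat.card (F ⟶ H)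

/-! ### Bilabelled objects in a category -/

section Bilabelled

variable {𝒞 : Type*} [Category 𝒞]

/-- A bilabelled object `L ⟶ A ⟵ K`. Mathlib's morphisms of these are the morphisms of their apices
that commute with the two legs. -/
abbrev Bilabelled (L K : 𝒞) := BinaryCofan L K

/-- The reverse `K ⟶ A ⟵ L` of `L ⟶ A ⟵ K`. -/
def Bilabelled.reverse {L K : 𝒞} (A : Bilabelled L K) : Bilabelled K L :=
  BinaryCofan.mk A.inr A.inl

/-- The series composition of `L ⟶ A ⟵ K` and `K ⟶ B ⟵ M`, with apex the pushout of
`A ⟵ K ⟶ B`. -/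
noncomputable def Bilabelled.series {L K M : 𝒞} (A : Bilabelled L K) (B : Bilabelled K M)
    [HasPushout A.inr B.inl] : Bilabelled L M :=
  BinaryCofan.mk (A.inl ≫ pushout.inl A.inr B.inl) (B.inr ≫ pushout.inr A.inr B.inl)

end Bilabelled

/-! ### Coalgebras on a fixed graph and the family `Λ(ℭ, L)` -/

/-- A `ℭ`-coalgebra structure `L ⟶ ℭ L` on the graph `L`. -/
structure CoalgebraOn (ℭ : Comonad FinGraph.{u}) (L : FinGraph.{u}) where
  a : L ⟶ ℭ.obj L
  counit : a ≫ ℭ.ε.app L = 𝟙 L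
  coassoc : a ≫ ℭ.δ.app L = a ≫ ℭ.map a

/-- The object `(L, a)` of the Eilenberg–Moore category. -/
def CoalgebraOn.toCoalgebra {ℭ : Comonad FinGraph.{u}} {L : FinGraph.{u}} (a : CoalgebraOn ℭ L) :
    ℭ.Coalgebra where
  A := L
  a := a.a
  counit := a.counit
  coassoc := a.coassoc

instance CoalgebraOn.finite (ℭ : Comonad FinGraph.{u}) (L : FinGraph.{u}) :
    Finite (CoalgebraOn ℭ L) :=
  Finite.of_injective (fun a : CoalgebraOn ℭ L => a.a) (by
    rintro ⟨a, _, _⟩ ⟨b, _, _⟩ h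
    cases h
    rfl)

noncomputable instance CoalgebraOn.fintype (ℭ : Comonad FinGraph.{u}) (L : FinGraph.{u}) :
    Fintype (CoalgebraOn ℭ L) :=
  Fintype.ofFinite _

/-- The family `Λ(ℭ, L)`: all `(L, a) ⟶ (A, α) ⟵ (L, b)` in the Eilenberg–Moore category of `ℭ`,
together with a fresh symbol `bot`. -/
inductive BilabelledCoalgebra (ℭ : Comonad FinGraph.{u}) (L : FinGraph.{u}) where
  | bot : BilabelledCoalgebra ℭ L
  | mk (a b : CoalgebraOn ℭ L) (A : Bilabelled a.toCoalgebra b.toCoalgebra) :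
      BilabelledCoalgebra ℭ L

namespace BilabelledCoalgebra

variable {ℭ : Comonad FinGraph.{u}} {L : FinGraph.{u}}

/-- Elements of `Λ(ℭ, L)` are identified when they are both `bot` or are isomorphic bilabelled
objects with the same coalgebra structures on the labels. -/
inductive Iso : BilabelledCoalgebra ℭ L → BilabelledCoalgebra ℭ L → Prop
  | bot : Iso .bot .bot
  | mk (a b : CoalgebraOn ℭ L) (A B : Bilabelled a.toCoalgebra b.toCoalgebra)
      (e : Nonempty (A ≅ B)) : Iso (.mk a b A) (.mk a b B)

/-- Reversal. -/
def reverse : BilabelledCoalgebra ℭ L → BilabelledCoalgebra ℭ L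
  | bot => bot
  | mk a b A => mk b a A.reverse

open Classical in
/-- Series composition: defined through the pushout if the two coalgebra structures in the middle
agree, and `bot` if they do not. Simple graphs have no loops, so two bilabelled coalgebras may fail
to have a pushout (when gluing would identify adjacent vertices); the result is then `bot` too. -/
noncomputable def series : BilabelledCoalgebra ℭ L → BilabelledCoalgebra ℭ L →
    BilabelledCoalgebra ℭ L
  | mk a b A, mk b' c B =>
    if h : b' = b then
      let B' : Bilabelled b.toCoalgebra c.toCoalgebra := h ▸ B
      if _hp : HasPushout A.inr B'.inl then mk a c (A.series B') else bot
    else bot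
  | _, _ => bot

/-- `Γ` generates `Λ(ℭ, L)`: up to isomorphism every element is a series composition of finitely
many (at least one) elements of `Γ`. -/
def IsGeneratingSet (Γ : Set (BilabelledCoalgebra ℭ L)) : Prop :=
  ∀ A : BilabelledCoalgebra ℭ L, ∃ B ∈ Γ, ∃ Bs : List (BilabelledCoalgebra ℭ L),
    (∀ B' ∈ Bs, B' ∈ Γ) ∧ Iso A (Bs.foldl series B)

/-- `Γ` is closed under reversal (up to isomorphism). -/
def IsReversalClosed (Γ : Set (BilabelledCoalgebra ℭ L)) : Prop :=
  ∀ A ∈ Γ, ∃ B ∈ Γ, Iso B A.reverse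

variable (ℭ L) in
/-- The graphs underlying `Λ(ℭ, L)`, i.e. the unlabellings of its elements other than `bot`. -/
def underlyingGraphs : Set FinGraph.{u} :=
  {F | ∃ (a b : CoalgebraOn ℭ L) (A : Bilabelled a.toCoalgebra b.toCoalgebra), F = A.pt.A}

end BilabelledCoalgebra

/-! ### Homomorphism representations -/

/-- The coalgebra morphism `(A, α) ⟶ (ℭ G, δ_G)` that corresponds to `f : A ⟶ G` under the
adjunction of the forgetful functor and the cofree functor. -/
def transposeHom {ℭ : Comonad FinGraph.{u}} (A : ℭ.Coalgebra) {G : FinGraph.{u}} (f : A.A ⟶ G) :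
    A ⟶ ℭ.cofree.obj G :=
  ℭ.adj.homEquiv A G f

/-- The comonadic homomorphism representation: the entry at `(l, k)` is the number of homomorphisms
`A ⟶ G` whose transpose restricts to the transposes of `l` and `k` along the two labels. -/
noncomputable def homMatrix {ℭ : Comonad FinGraph.{u}} {L : FinGraph.{u}} {a b : CoalgebraOn ℭ L}
    (A : Bilabelled a.toCoalgebra b.toCoalgebra) (G : FinGraph.{u}) :
    Matrix (L ⟶ G) (L ⟶ G) ℂ :=
  Matrix.of fun l k =>
    (Nat.card {h : A.pt.A ⟶ G //
      A.inl ≫ transposeHom A.pt h = transposeHom a.toCoalgebra l ∧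
      A.inr ≫ transposeHom A.pt h = transposeHom b.toCoalgebra k} : ℂ)

open Classical in
/-- The augmented homomorphism representation `A_G ⊗ e_a e_bᵀ`, as a matrix with respect to the
standard basis of `ℂ^(mor(L, G)) ⊗ ⨁_a ℂ`, with `a` ranging over the coalgebra structures on `L`;
`bot` is sent to the zero matrix. -/
noncomputable def augHomMatrix {ℭ : Comonad FinGraph.{u}} {L : FinGraph.{u}} (G : FinGraph.{u}) :
    BilabelledCoalgebra ℭ L →
      Matrix ((L ⟶ G) × CoalgebraOn ℭ L) ((L ⟶ G) × CoalgebraOn ℭ L) ℂ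
  | .bot => 0
  | .mk a b A => homMatrix A G ⊗ₖ Matrix.vecMulVec (Pi.single a 1) (Pi.single b 1)

/-- A complex matrix is pseudo-stochastic if all its row sums and column sums are one. -/
def IsPseudoStochastic {I J : Type*} [Fintype I] [Fintype J] (X : Matrix J I ℂ) : Prop :=
  (∀ j, ∑ i, X j i = 1) ∧ (∀ i, ∑ j, X j i = 1)

/-! By adjunction, a homomorphism out of an Eilenberg–Moore pushout is a pair of homomorphisms
agreeing on the middle label. Hence series composition becomes the matrix product
(`homMatrix_series`). The value `bot` is consistent with this: where no pushout exists, no such pair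
exists either, so the product vanishes (`homMatrix_mul_eq_zero`). Reversal becomes the conjugate
transpose, and the sum of all entries counts all homomorphisms.

If `X` intertwines the generators, it intertwines all their products; pairing with the all-ones
vector `1` on both sides removes `X` and leaves equal counts.

Conversely, equal counts say that the vectors `A_G 1` and `A_H 1`, for `A` in `Λ(ℭ, L)`, have the
same Gram matrix. So `A_G 1 ↦ A_H 1` is a well-defined isometry between their spans; extended by
zero on the orthogonal complement, it intertwines the two representations (`exists_intertwiner`).
The identity matrix is a sum of represented matrices (`sum_augHomMatrix_refl`), so `1` lies in both
spans; thus `X` and its adjoint exchange the all-ones vectors, which is pseudo-stochasticity. -/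

/-! ### Intertwiners from equal Gram matrices. -/

section Intertwiner

open scoped InnerProductSpace

/-- Two families of operators closed under composition and adjoints, with the same matrix
coefficients at `x` and `y`, are intertwined by a linear map carrying `x` to `y` whose adjoint
carries `y` to `x`. -/
theorem exists_intertwiner {E F S : Type*} [NormedAddCommGroup E] [InnerProductSpace ℂ E]
    [FiniteDimensional ℂ E] [NormedAddCommGroup F] [InnerProductSpace ℂ F] [FiniteDimensional ℂ F]
    (φ : S → E →ₗ[ℂ] E) (ψ : S → F →ₗ[ℂ] F) (x : E) (y : F)
    (hmul : ∀ s t, ∃ r, φ r = φ s ∘ₗ φ t ∧ ψ r = ψ s ∘ₗ ψ t)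
    (hadj : ∀ s, ∃ t, φ t = (φ s).adjoint ∧ ψ t = (ψ s).adjoint)
    (hxy : ∀ s, ⟪x, φ s x⟫_ℂ = ⟪y, ψ s y⟫_ℂ)
    (e : S →₀ ℂ) (hex : Finsupp.linearCombination ℂ (fun s => φ s x) e = x)
    (hey : Finsupp.linearCombination ℂ (fun s => ψ s y) e = y) :
    ∃ X : E →ₗ[ℂ] F, (∀ s, X ∘ₗ φ s = ψ s ∘ₗ X) ∧ X x = y ∧ X.adjoint y = x := by
  set Φ := Finsupp.linearCombination ℂ (fun s => φ s x) with hΦ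
  set Ψ := Finsupp.linearCombination ℂ (fun s => ψ s y) with hΨ
  have inner_basis : ∀ s t, ⟪φ s x, φ t x⟫_ℂ = ⟪ψ s y, ψ t y⟫_ℂ := by
    intro s t
    obtain ⟨s', h1, h2⟩ := hadj s
    obtain ⟨r, h3, h4⟩ := hmul s' t
    have := hxy r
    rw [h3, h4, h1, h2] at this
    simpa [LinearMap.adjoint_inner_right] using this
  have inner_eq : ∀ c d, ⟪Φ c, Φ d⟫_ℂ = ⟪Ψ c, Ψ d⟫_ℂ := by
    intro c d
    simp [hΦ, hΨ, Finsupp.linearCombination_apply, Finsupp.sum, inner_basis]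
  have hker : ∀ c, Φ c = 0 → Ψ c = 0 := by
    intro c hc
    rw [← inner_self_eq_zero (𝕜 := ℂ), ← inner_eq, hc, inner_zero_left]
  -- `X` projects onto the range of `Φ`, picks any `Φ`-preimage and applies `Ψ`; by `hker` the
  -- choice of preimage is irrelevant.
  obtain ⟨r, hr⟩ := Φ.rangeRestrict.exists_rightInverse_of_surjective
    (LinearMap.range_rangeRestrict Φ)
  let P : E →ₗ[ℂ] Φ.range := (Φ.range.orthogonalProjectionOnto : E →L[ℂ] Φ.range)
  let X : E →ₗ[ℂ] F := Ψ ∘ₗ r ∘ₗ P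
  have hXΦ : ∀ c, X (Φ c) = Ψ c := by
    intro c
    have h1 : P (Φ c) = Φ.rangeRestrict c :=
      Submodule.orthogonalProjectionOnto_mem_subspace_eq_self (Φ.rangeRestrict c)
    have h2 : Φ (r (P (Φ c))) = Φ c := by
      rw [h1]
      exact congrArg Subtype.val (LinearMap.congr_fun hr (Φ.rangeRestrict c))
    have h3 := hker (r (P (Φ c)) - c) (by rw [map_sub, h2, sub_self])
    rwa [map_sub, sub_eq_zero] at h3
  have hX0 : ∀ v ∈ Φ.rangeᗮ, X v = 0 := by
    intro v hv
    have : P v = 0 := Submodule.orthogonalProjectionOnto_apply_of_mem_orthogonal hv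
    simp [X, this]
  have hdecomp : ∀ v : E, ∃ c, ∃ w ∈ Φ.rangeᗮ, v = Φ c + w := by
    intro v
    obtain ⟨_, ⟨c, rfl⟩, w, hw, h⟩ := Φ.range.exists_add_mem_mem_orthogonal v
    exact ⟨c, w, hw, h⟩
  refine ⟨X, fun s => ?_, by rw [← hex, hXΦ, hey], ?_⟩
  · have hΦs : X ∘ₗ φ s ∘ₗ Φ = ψ s ∘ₗ Ψ := by
      refine Finsupp.lhom_ext' fun t => LinearMap.ext_ring ?_
      obtain ⟨r, h1, h2⟩ := hmul s t
      have h3 := hXΦ (Finsupp.single r 1)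
      simp only [hΦ, hΨ, Finsupp.linearCombination_single, one_smul, h1, h2] at h3
      simpa [hΦ, hΨ] using h3
    ext v
    obtain ⟨c, w, hw, rfl⟩ := hdecomp v
    -- The range of `Φ` is stable under the adjoint of `φ s`, which is again in the family, so `φ s`
    -- preserves its orthogonal complement.
    have hw' : φ s w ∈ Φ.rangeᗮ := by
      rw [Submodule.mem_orthogonal]
      rintro _ ⟨d, rfl⟩
      induction d using Finsupp.induction_linear with
      | zero => simp
      | add f g hf hg => simp [inner_add_left, hf, hg]
      | single t a =>
        obtain ⟨s', h1, -⟩ := hadj s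
        obtain ⟨r, h2, -⟩ := hmul s' t
        have h3 := (Submodule.mem_orthogonal _ _).1 hw (Φ (Finsupp.single r a)) ⟨_, rfl⟩
        rw [hΦ, Finsupp.linearCombination_single, h2, h1] at h3
        rw [hΦ, Finsupp.linearCombination_single]
        simpa [inner_smul_left, LinearMap.adjoint_inner_left] using h3
    have h1 := LinearMap.congr_fun hΦs c
    simp only [LinearMap.comp_apply] at h1
    simp [hX0 _ hw, hX0 _ hw', h1, hXΦ]
  · refine ext_inner_right ℂ fun v => ?_
    rw [LinearMap.adjoint_inner_left]
    obtain ⟨c, w, hw, rfl⟩ := hdecomp v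
    have h0 : ⟪x, w⟫_ℂ = 0 := (Submodule.mem_orthogonal _ _).1 hw x ⟨e, hex⟩
    have h1 := inner_eq e c
    rw [hex, hey] at h1
    rw [map_add, hX0 w hw, hXΦ, add_zero, inner_add_right, h0, add_zero, h1]

open Matrix in
/-- Families of matrices closed under products and conjugate transposes, with equal sums of entries
and containing the identity in their span, are intertwined by a pseudo-stochastic matrix. -/
theorem exists_isPseudoStochastic_intertwiner {I J S : Type*} [Fintype I] [Fintype J]
    [DecidableEq I] [DecidableEq J] (φ : S → Matrix I I ℂ) (ψ : S → Matrix J J ℂ)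
    (hmul : ∀ s t, ∃ r, φ r = φ s * φ t ∧ ψ r = ψ s * ψ t)
    (hstar : ∀ s, ∃ t, φ t = (φ s)ᴴ ∧ ψ t = (ψ s)ᴴ)
    (hsum : ∀ s, ∑ i, ∑ i', φ s i i' = ∑ j, ∑ j', ψ s j j')
    (e : S →₀ ℂ) (heφ : Finsupp.linearCombination ℂ φ e = 1)
    (heψ : Finsupp.linearCombination ℂ ψ e = 1) :
    ∃ X : Matrix J I ℂ, IsPseudoStochastic X ∧ ∀ s, X * φ s = ψ s * X := by
  have key : ∃ X : EuclideanSpace ℂ I →ₗ[ℂ] EuclideanSpace ℂ J,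
      (∀ s, X ∘ₗ toEuclideanLin (φ s) = toEuclideanLin (ψ s) ∘ₗ X) ∧
        X (WithLp.toLp 2 1) = WithLp.toLp 2 1 ∧
        X.adjoint (WithLp.toLp 2 1) = WithLp.toLp 2 1 := by
    refine exists_intertwiner (fun s => toEuclideanLin (φ s)) (fun s => toEuclideanLin (ψ s))
      _ _ (fun s t => ?_) (fun s => ?_) (fun s => ?_) e ?_ ?_
    · obtain ⟨r, h1, h2⟩ := hmul s t
      exact ⟨r, by simp only [h1, toLpLin_mul_same], by simp only [h2, toLpLin_mul_same]⟩
    · obtain ⟨t, h1, h2⟩ := hstar s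
      exact ⟨t, by simp only [h1, toEuclideanLin_conjTranspose_eq_adjoint],
        by simp only [h2, toEuclideanLin_conjTranspose_eq_adjoint]⟩
    -- The sum of all entries is the matrix coefficient at the all-ones vector.
    · have := hsum s
      simpa [EuclideanSpace.inner_eq_star_dotProduct, mulVec, dotProduct] using this
    · have := congrArg (fun M => toEuclideanLin M (WithLp.toLp 2 1)) heφ
      simpa [Finsupp.linearCombination_apply, Finsupp.sum] using this
    · have := congrArg (fun M => toEuclideanLin M (WithLp.toLp 2 1)) heψ
      simpa [Finsupp.linearCombination_apply, Finsupp.sum] using this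
  obtain ⟨X, hX, hx, hy⟩ := key
  obtain ⟨M, rfl⟩ := (toEuclideanLin (𝕜 := ℂ)).surjective X
  refine ⟨M, ⟨fun j => ?_, fun i => ?_⟩, fun s => ?_⟩
  · have := congrArg (fun v => v j) hx
    simpa [mulVec, dotProduct] using this
  · rw [← toEuclideanLin_conjTranspose_eq_adjoint] at hy
    -- The adjoint yields conjugated column sums; `star` undoes the conjugation.
    have := congrArg (fun v => star (v i)) hy
    simpa [mulVec, dotProduct] using this
  · apply (toEuclideanLin (𝕜 := ℂ)).injective
    have := hX s
    rwa [toLpLin_mul_same, toLpLin_mul_same]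

end Intertwiner

/-! ### Pushouts of finite simple graphs. -/

namespace FinGraph

section Pushout

variable {K A B G : FinGraph.{u}} (f : K ⟶ A) (g : K ⟶ B)

/-- The relation gluing `A` and `B` along `K`. -/
inductive GlueRel : A.V ⊕ B.V → A.V ⊕ B.V → Prop
  | glue (v : K.V) : GlueRel (.inl (f.toFun v)) (.inr (g.toFun v))

/-- The vertices of the graph obtained by gluing `A` and `B` along `K`. -/
def Glue : Type u := Quot (GlueRel f g)

variable {f g}

/-- The map out of the glued vertex set induced by a cocone. -/
def glueDesc (p : A ⟶ G) (q : B ⟶ G) (w : f ≫ p = g ≫ q) : Glue f g → G.V :=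
  Quot.lift (Sum.elim p.toFun q.toFun) (by
    rintro _ _ ⟨v⟩
    exact congrArg (fun h : K ⟶ G => h.toFun v) w)

variable (f g) in
/-- The graph obtained by gluing `A` and `B` along `K`, with possible loops deleted. -/
def glueGraph : FinGraph.{u} where
  V := Glue f g
  finite := by
    have := A.finite
    have := B.finite
    exact Quot.finite _
  graph := SimpleGraph.fromRel fun x y =>
    (∃ v w, A.graph.Adj v w ∧ x = Quot.mk _ (.inl v) ∧ y = Quot.mk _ (.inl w)) ∨
    (∃ v w, B.graph.Adj v w ∧ x = Quot.mk _ (.inr v) ∧ y = Quot.mk _ (.inr w))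

/-- A cocone rules out loops in the glued graph. -/
def glueInl (p : A ⟶ G) (q : B ⟶ G) (w : f ≫ p = g ≫ q) : A ⟶ glueGraph f g where
  toFun v := Quot.mk _ (.inl v)
  map_rel' {a b} h := by
    refine (SimpleGraph.fromRel_adj _ _ _).2 ⟨fun e => ?_, Or.inl (Or.inl ⟨a, b, h, rfl, rfl⟩)⟩
    exact (p.map_rel' h).ne (congrArg (glueDesc p q w) e)

/-- A cocone rules out loops in the glued graph. -/
def glueInr (p : A ⟶ G) (q : B ⟶ G) (w : f ≫ p = g ≫ q) : B ⟶ glueGraph f g where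
  toFun v := Quot.mk _ (.inr v)
  map_rel' {a b} h := by
    refine (SimpleGraph.fromRel_adj _ _ _).2 ⟨fun e => ?_, Or.inl (Or.inr ⟨a, b, h, rfl, rfl⟩)⟩
    exact (q.map_rel' h).ne (congrArg (glueDesc p q w) e)

/-- The homomorphism out of the glued graph induced by a cocone. -/
def glueDescHom (p : A ⟶ G) (q : B ⟶ G) (w : f ≫ p = g ≫ q) : glueGraph f g ⟶ G where
  toFun := glueDesc p q w
  map_rel' {a b} hab := by
    obtain ⟨-, (⟨v, w, h, rfl, rfl⟩ | ⟨v, w, h, rfl, rfl⟩) |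
      (⟨v, w, h, rfl, rfl⟩ | ⟨v, w, h, rfl, rfl⟩)⟩ := (SimpleGraph.fromRel_adj _ _ _).1 hab
    · exact p.map_rel' h
    · exact q.map_rel' h
    · exact (p.map_rel' h).symm
    · exact (q.map_rel' h).symm

/-- A span of finite simple graphs that admits some cocone has a pushout. -/
theorem hasPushout_of_cocone (p : A ⟶ G) (q : B ⟶ G) (w : f ≫ p = g ≫ q) : HasPushout f g := by
  have hw : f ≫ glueInl p q w = g ≫ glueInr p q w :=
    RelHom.ext fun v => Quot.sound (GlueRel.glue v)
  refine ⟨⟨⟨PushoutCocone.mk _ _ hw, PushoutCocone.isColimitAux' _ fun s =>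
    ⟨glueDescHom s.inl s.inr s.condition, rfl, rfl, fun {m} h1 h2 => ?_⟩⟩⟩⟩
  refine RelHom.ext fun x => ?_
  obtain ⟨v | v, rfl⟩ := Quot.exists_rep x
  · exact congrArg (fun h : A ⟶ s.pt => h.toFun v) h1
  · exact congrArg (fun h : B ⟶ s.pt => h.toFun v) h2

end Pushout

end FinGraph

/-! ### Pushouts of coalgebras and homomorphisms out of them. -/

section Coalgebra

variable {ℭ : Comonad FinGraph.{u}}

/-- A span of coalgebras has a pushout as soon as its underlying span of graphs has a cocone. -/
theorem hasPushout_coalgebra_of_cocone {K A B : ℭ.Coalgebra} {G : FinGraph.{u}} (f : K ⟶ A)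
    (g : K ⟶ B) (p : A.A ⟶ G) (q : B.A ⟶ G) (w : f.f ≫ p = g.f ≫ q) : HasPushout f g := by
  -- The forgetful functor creates colimits, so a pushout of the underlying graphs suffices.
  have : HasPushout (ℭ.forget.map f) (ℭ.forget.map g) := FinGraph.hasPushout_of_cocone p q w
  have : HasColimit (span f g ⋙ ℭ.forget) := hasColimit_of_iso (spanCompIso ℭ.forget f g)
  exact Comonad.hasColimit_of_comp_forget_hasColimit _

theorem comp_transposeHom {A B : ℭ.Coalgebra} {G : FinGraph.{u}} (f : A ⟶ B) (h : B.A ⟶ G) :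
    f ≫ transposeHom B h = transposeHom A (f.f ≫ h) :=
  (ℭ.adj.homEquiv_naturality_left f h).symm

theorem transposeHom_injective (A : ℭ.Coalgebra) (G : FinGraph.{u}) :
    Function.Injective (transposeHom A (G := G)) :=
  (ℭ.adj.homEquiv A G).injective

theorem transposeHom_surjective (A : ℭ.Coalgebra) (G : FinGraph.{u}) :
    Function.Surjective (transposeHom A (G := G)) :=
  (ℭ.adj.homEquiv A G).surjective

/-- Graph homomorphisms into `G` are coalgebra morphisms into the cofree coalgebra on `G`, so the
universal property of the coalgebra pushout applies to them. -/
theorem pushout_coalgebra_hom_ext {K A B : ℭ.Coalgebra} {f : K ⟶ A} {g : K ⟶ B} [HasPushout f g]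
    {G : FinGraph.{u}} {h h' : (pushout f g).A ⟶ G}
    (h₁ : (pushout.inl f g).f ≫ h = (pushout.inl f g).f ≫ h')
    (h₂ : (pushout.inr f g).f ≫ h = (pushout.inr f g).f ≫ h') : h = h' := by
  apply transposeHom_injective
  apply pushout.hom_ext
  · rw [comp_transposeHom, comp_transposeHom, h₁]
  · rw [comp_transposeHom, comp_transposeHom, h₂]

theorem exists_pushout_coalgebra_desc {K A B : ℭ.Coalgebra} {f : K ⟶ A} {g : K ⟶ B}
    [HasPushout f g] {G : FinGraph.{u}} (p : A.A ⟶ G) (q : B.A ⟶ G) (w : f.f ≫ p = g.f ≫ q) :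
    ∃ h : (pushout f g).A ⟶ G, (pushout.inl f g).f ≫ h = p ∧ (pushout.inr f g).f ≫ h = q := by
  obtain ⟨h, hh⟩ := transposeHom_surjective (pushout f g) G
    (pushout.desc (transposeHom A p) (transposeHom B q) (by
      rw [comp_transposeHom, comp_transposeHom, w]))
  refine ⟨h, transposeHom_injective _ _ ?_, transposeHom_injective _ _ ?_⟩
  · rw [← comp_transposeHom, hh, pushout.inl_desc]
  · rw [← comp_transposeHom, hh, pushout.inr_desc]

end Coalgebra

/-! ### Homomorphism matrices: entry sums, reversal, series composition. -/

section HomMatrix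

variable {ℭ : Comonad FinGraph.{u}} {L : FinGraph.{u}} {a b c : CoalgebraOn ℭ L}

/-- Restriction of a homomorphism along the first label. -/
def restrictInl (A : Bilabelled a.toCoalgebra b.toCoalgebra) {G : FinGraph.{u}} (h : A.pt.A ⟶ G) :
    L ⟶ G :=
  A.inl.f ≫ h

/-- Restriction of a homomorphism along the second label. -/
def restrictInr (A : Bilabelled a.toCoalgebra b.toCoalgebra) {G : FinGraph.{u}} (h : A.pt.A ⟶ G) :
    L ⟶ G :=
  A.inr.f ≫ h

/-- Transposition is natural and injective, so the conditions on transposes reduce to conditions on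
restrictions of graph homomorphisms. -/
theorem homMatrix_apply (A : Bilabelled a.toCoalgebra b.toCoalgebra) (G : FinGraph.{u})
    (l k : L ⟶ G) :
    homMatrix A G l k =
      (Nat.card {h : A.pt.A ⟶ G // restrictInl A h = l ∧ restrictInr A h = k} : ℂ) := by
  refine congrArg Nat.cast (Nat.card_congr (Equiv.subtypeEquivRight fun h => and_congr ?_ ?_))
  · refine (Eq.congr_left (comp_transposeHom _ h)).trans ?_
    exact (transposeHom_injective a.toCoalgebra G).eq_iff
  · refine (Eq.congr_left (comp_transposeHom _ h)).trans ?_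
    exact (transposeHom_injective b.toCoalgebra G).eq_iff

theorem sum_homMatrix (A : Bilabelled a.toCoalgebra b.toCoalgebra) (G : FinGraph.{u}) :
    ∑ l, ∑ k, homMatrix A G l k = (Nat.card (A.pt.A ⟶ G) : ℂ) := by
  refine (Fintype.sum_prod_type' fun l k => homMatrix A G l k).symm.trans ?_
  rw [← Nat.card_congr (Equiv.sigmaFiberEquiv fun h : A.pt.A ⟶ G => (restrictInl A h, restrictInr A h)),
    Nat.card_sigma, Nat.cast_sum]
  refine Finset.sum_congr rfl fun p _ => ?_
  rw [homMatrix_apply]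
  exact congrArg Nat.cast (Nat.card_congr (Equiv.subtypeEquivRight fun h => by
    rw [Prod.ext_iff]))

theorem homMatrix_reverse (A : Bilabelled a.toCoalgebra b.toCoalgebra) (G : FinGraph.{u}) :
    homMatrix A.reverse G = (homMatrix A G).conjTranspose := by
  ext l k
  rw [Matrix.conjTranspose_apply, homMatrix_apply, homMatrix_apply]
  simp only [star_natCast]
  exact congrArg Nat.cast (Nat.card_congr (Equiv.subtypeEquivRight fun h => and_comm))

theorem homMatrix_congr {A B : Bilabelled a.toCoalgebra b.toCoalgebra} (e : A ≅ B)
    (G : FinGraph.{u}) : homMatrix A G = homMatrix B G := by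
  ext l k
  rw [homMatrix_apply, homMatrix_apply]
  have h₁ : B.inl ≫ e.inv.hom = A.inl := e.inv.w ⟨WalkingPair.left⟩
  have h₂ : B.inr ≫ e.inv.hom = A.inr := e.inv.w ⟨WalkingPair.right⟩
  refine congrArg Nat.cast (Nat.card_congr ((Iso.homFromEquiv
    (ℭ.forget.mapIso ((Cocone.forget _).mapIso e))).subtypeEquiv fun h => ?_))
  have h₃ : restrictInl A h = restrictInl B (e.inv.hom.f ≫ h) :=
    congrArg (fun f => f.f ≫ h) h₁.symm
  have h₄ : restrictInr A h = restrictInr B (e.inv.hom.f ≫ h) :=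
    congrArg (fun f => f.f ≫ h) h₂.symm
  rw [h₃, h₄]
  rfl

open Classical in
theorem homMatrix_refl (a : CoalgebraOn ℭ L) (G : FinGraph.{u}) :
    homMatrix (BinaryCofan.mk (𝟙 a.toCoalgebra) (𝟙 a.toCoalgebra)) G = 1 := by
  ext l k
  have h : Nat.card {h : L ⟶ G // h = l ∧ h = k} = if l = k then 1 else 0 := by
    split_ifs with hlk
    · subst hlk
      simp
    · have : IsEmpty {h : L ⟶ G // h = l ∧ h = k} := ⟨fun ⟨h, h₁, h₂⟩ => hlk (h₁.symm.trans h₂)⟩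
      exact Nat.card_of_isEmpty
  rw [homMatrix_apply, Matrix.one_apply]
  refine (congrArg Nat.cast h).trans ?_
  split_ifs <;> simp

/-- Homomorphisms out of a series composition are pairs that agree on the middle label. -/
theorem homMatrix_series (A : Bilabelled a.toCoalgebra b.toCoalgebra)
    (B : Bilabelled b.toCoalgebra c.toCoalgebra) [HasPushout A.inr B.inl] (G : FinGraph.{u}) :
    homMatrix (A.series B) G = homMatrix A G * homMatrix B G := by
  ext l m
  rw [Matrix.mul_apply, homMatrix_apply]
  simp only [homMatrix_apply, ← Nat.cast_mul, ← Nat.card_prod, ← Nat.cast_sum, ← Nat.card_sigma]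
  let P := {p : (A.pt.A ⟶ G) × (B.pt.A ⟶ G) //
    restrictInl A p.1 = l ∧ restrictInr A p.1 = restrictInl B p.2 ∧ restrictInr B p.2 = m}
  -- The index `k` of the matrix product is the common restriction to the middle label.
  let e₁ : P ≃ Σ k : L ⟶ G, {h : A.pt.A ⟶ G // restrictInl A h = l ∧ restrictInr A h = k} ×
      {h : B.pt.A ⟶ G // restrictInl B h = k ∧ restrictInr B h = m} :=
    { toFun := fun p => ⟨restrictInl B p.1.2, ⟨p.1.1, p.2.1, p.2.2.1⟩, ⟨p.1.2, rfl, p.2.2.2⟩⟩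
      invFun := fun q => ⟨(q.2.1.1, q.2.2.1), q.2.1.2.1, q.2.1.2.2.trans q.2.2.2.1.symm,
        q.2.2.2.2⟩
      left_inv := fun _ => rfl
      right_inv := by
        rintro ⟨_, ⟨h, h₁, h₂⟩, ⟨h', rfl, h₃⟩⟩
        rfl }
  rw [← Nat.card_congr e₁]
  refine congrArg Nat.cast (Nat.card_congr (Equiv.ofBijective (fun h =>
    (⟨((pushout.inl A.inr B.inl).f ≫ h.1, (pushout.inr A.inr B.inl).f ≫ h.1),
      h.2.1, ?_, h.2.2⟩ : P)) ⟨?_, ?_⟩))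
  · exact congrArg (fun f => f.f ≫ h.1) (pushout.condition (f := A.inr) (g := B.inl))
  · rintro ⟨h, _⟩ ⟨h', _⟩ hh
    have hh := Prod.ext_iff.1 (Subtype.ext_iff.1 hh)
    exact Subtype.ext (pushout_coalgebra_hom_ext hh.1 hh.2)
  · rintro ⟨⟨p, q⟩, h₁, h₂, h₃⟩
    obtain ⟨h, rfl, rfl⟩ := exists_pushout_coalgebra_desc (f := A.inr) (g := B.inl) p q h₂
    exact ⟨⟨h, h₁, h₃⟩, rfl⟩

/-- A nonzero entry would supply two homomorphisms agreeing on the middle label, a cocone that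
forces the pushout to exist. -/
theorem homMatrix_mul_eq_zero (A : Bilabelled a.toCoalgebra b.toCoalgebra)
    (B : Bilabelled b.toCoalgebra c.toCoalgebra) (h : ¬ HasPushout A.inr B.inl) (G : FinGraph.{u}) :
    homMatrix A G * homMatrix B G = 0 := by
  ext l m
  rw [Matrix.mul_apply]
  refine Finset.sum_eq_zero fun k _ => ?_
  rw [homMatrix_apply, homMatrix_apply, ← Nat.cast_mul, ← Nat.card_prod, Nat.cast_eq_zero]
  have : IsEmpty ({h : A.pt.A ⟶ G // restrictInl A h = l ∧ restrictInr A h = k} ×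
      {h : B.pt.A ⟶ G // restrictInl B h = k ∧ restrictInr B h = m}) :=
    ⟨fun ⟨⟨p, _, hp⟩, ⟨q, hq, _⟩⟩ =>
      h (hasPushout_coalgebra_of_cocone A.inr B.inl p q (hp.trans hq.symm))⟩
  exact Nat.card_of_isEmpty

end HomMatrix

/-! ### The augmented representation. -/

section AugHomMatrix

variable {ℭ : Comonad FinGraph.{u}} {L : FinGraph.{u}}

open BilabelledCoalgebra

theorem augHomMatrix_series (G : FinGraph.{u}) (A B : BilabelledCoalgebra ℭ L) :
    augHomMatrix G (A.series B) = augHomMatrix G A * augHomMatrix G B := by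
  classical
  rcases A with _ | ⟨a, b, A⟩
  · simp [series, augHomMatrix]
  rcases B with _ | ⟨b', c, B⟩
  · simp [series, augHomMatrix]
  simp only [augHomMatrix]
  rw [← Matrix.mul_kronecker_mul, Matrix.vecMulVec_mul_vecMulVec]
  by_cases h : b' = b
  · subst h
    by_cases hp : HasPushout A.inr B.inl
    · simp only [series, hp, dite_true]
      rw [homMatrix_series]
      simp
    · simp only [series, hp, dite_true, dite_false]
      rw [homMatrix_mul_eq_zero _ _ hp]
      simp
  · simp only [series, h, dite_false]
    -- Distinct middle structures give orthogonal basis vectors.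
    simp [Ne.symm h]

theorem augHomMatrix_reverse (G : FinGraph.{u}) (A : BilabelledCoalgebra ℭ L) :
    augHomMatrix G A.reverse = (augHomMatrix G A).conjTranspose := by
  classical
  rcases A with _ | ⟨a, b, A⟩
  · simp [reverse, augHomMatrix]
  · simp only [reverse, augHomMatrix]
    rw [homMatrix_reverse, Matrix.conjTranspose_kronecker, Matrix.conjTranspose_vecMulVec,
      ← Pi.single_star, ← Pi.single_star, star_one]

theorem augHomMatrix_congr (G : FinGraph.{u}) {A B : BilabelledCoalgebra ℭ L} (h : Iso A B) :
    augHomMatrix G A = augHomMatrix G B := by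
  rcases h with _ | ⟨a, b, A, B, ⟨e⟩⟩
  · rfl
  · simp only [augHomMatrix, homMatrix_congr e]

theorem sum_augHomMatrix_mk (G : FinGraph.{u}) {a b : CoalgebraOn ℭ L}
    (A : Bilabelled a.toCoalgebra b.toCoalgebra) :
    ∑ i, ∑ j, augHomMatrix G (.mk a b A) i j = (Nat.card (A.pt.A ⟶ G) : ℂ) := by
  classical
  simp only [augHomMatrix, Fintype.sum_prod_type, Matrix.kroneckerMap_apply,
    Matrix.vecMulVec_apply, ← Finset.mul_sum, ← sum_homMatrix]
  simp [Pi.single_apply]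

open Classical in
theorem sum_augHomMatrix_refl (G : FinGraph.{u}) :
    ∑ a : CoalgebraOn ℭ L, augHomMatrix G
      (.mk a a (BinaryCofan.mk (𝟙 a.toCoalgebra) (𝟙 a.toCoalgebra))) = 1 := by
  ext ⟨l, a⟩ ⟨k, b⟩
  simp only [augHomMatrix, homMatrix_refl, Matrix.sum_apply, Matrix.kroneckerMap_apply,
    Matrix.vecMulVec_apply, Matrix.one_apply, Prod.mk.injEq, Pi.single_apply]
  by_cases h : l = k <;> by_cases h' : a = b <;> simp [h, h']

end AugHomMatrix

/-! ### The equivalence. -/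

theorem mainTheorem10 (ℭ : Comonad FinGraph.{u}) (L : FinGraph.{u})
    (hL : L ∈ Set.range ℭ.forget.obj)
    (Γ : Set (BilabelledCoalgebra ℭ L))
    (hgen : BilabelledCoalgebra.IsGeneratingSet Γ)
    (hrev : BilabelledCoalgebra.IsReversalClosed Γ)
    (G H : FinGraph.{u}) :
    HomIndistinguishable (BilabelledCoalgebra.underlyingGraphs ℭ L) G H ↔
      ∃ X : Matrix ((L ⟶ H) × CoalgebraOn ℭ L) ((L ⟶ G) × CoalgebraOn ℭ L) ℂ,
        IsPseudoStochastic X ∧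
          ∀ A ∈ Γ, X * augHomMatrix G A = augHomMatrix H A * X := by
  classical
  constructor
  · intro hGH
    obtain ⟨X, hX, hXA⟩ := exists_isPseudoStochastic_intertwiner
      (augHomMatrix G : BilabelledCoalgebra ℭ L → _) (augHomMatrix H)
      (fun A B => ⟨A.series B, augHomMatrix_series G A B, augHomMatrix_series H A B⟩)
      (fun A => ⟨A.reverse, augHomMatrix_reverse G A, augHomMatrix_reverse H A⟩)
      (fun A => by
        rcases A with _ | ⟨a, b, A⟩
        · simp [augHomMatrix]
        · rw [sum_augHomMatrix_mk, sum_augHomMatrix_mk, hGH _ ⟨a, b, A, rfl⟩])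
      (∑ a : CoalgebraOn ℭ L, Finsupp.single
        (.mk a a (BinaryCofan.mk (𝟙 a.toCoalgebra) (𝟙 a.toCoalgebra))) 1)
      (by
        simp only [map_sum, Finsupp.linearCombination_single, one_smul]
        exact sum_augHomMatrix_refl G)
      (by
        simp only [map_sum, Finsupp.linearCombination_single, one_smul]
        exact sum_augHomMatrix_refl H)
    exact ⟨X, hX, fun A _ => hXA A⟩
  · rintro ⟨X, ⟨hrow, hcol⟩, hXΓ⟩ _ ⟨a, b, A, rfl⟩
    have hfold : ∀ (Bs : List (BilabelledCoalgebra ℭ L)) (B : BilabelledCoalgebra ℭ L),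
        (∀ B' ∈ Bs, B' ∈ Γ) → X * augHomMatrix G B = augHomMatrix H B * X →
        X * augHomMatrix G (Bs.foldl .series B) = augHomMatrix H (Bs.foldl .series B) * X := by
      intro Bs
      induction Bs with
      | nil => exact fun B _ h => h
      | cons C Bs ih =>
        intro B hBs hB
        refine ih _ (fun B' hB' => hBs B' (List.mem_cons_of_mem _ hB')) ?_
        rw [augHomMatrix_series, augHomMatrix_series, ← Matrix.mul_assoc, hB, Matrix.mul_assoc,
          hXΓ C (hBs C List.mem_cons_self), Matrix.mul_assoc]
    obtain ⟨B, hB, Bs, hBs, hiso⟩ := hgen (.mk a b A)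
    have hA : X * augHomMatrix G (.mk a b A) = augHomMatrix H (.mk a b A) * X := by
      rw [augHomMatrix_congr G hiso, augHomMatrix_congr H hiso]
      exact hfold Bs B hBs (hXΓ B hB)
    have hX1 : X.mulVec 1 = 1 := by
      ext j
      simpa [Matrix.mulVec, dotProduct] using hrow j
    have h1X : Matrix.vecMul 1 X = 1 := by
      ext i
      simpa [Matrix.vecMul, dotProduct] using hcol i
    -- With `A_G`, `A_H` the two matrices of `A`: `1ᵀ A_G 1 = 1ᵀ X A_G 1 = 1ᵀ A_H X 1 = 1ᵀ A_H 1`,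
    -- by the column sums, `hA` and the row sums.
    have hsum : dotProduct 1 ((augHomMatrix G (.mk a b A)).mulVec 1) =
        dotProduct 1 ((augHomMatrix H (.mk a b A)).mulVec 1) := by
      have := congrArg (fun M : Matrix _ _ ℂ => dotProduct 1 (M.mulVec 1)) hA
      simp only [← Matrix.mulVec_mulVec, hX1] at this
      rwa [Matrix.dotProduct_mulVec, h1X] at this
    have hcard : (Nat.card (A.pt.A ⟶ G) : ℂ) = Nat.card (A.pt.A ⟶ H) := by
      rw [← sum_augHomMatrix_mk, ← sum_augHomMatrix_mk]
      simpa [Matrix.mulVec, dotProduct] using hsum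
    exact_mod_cast hcard
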